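/- **Setting.** All manifolds, maps and actions are smooth ($C^\infty$) and all manifolds and vector spaces are finite-dimensional. Let $G$ be a Lie group with Lie algebra $\mathfrak g$, let $\pi : P\to M$ be a principal $G$-bundle with principal right action $\rho_g(p)=p\cdot g$, and let $G$ act linearly from the left on a real vector space $W$. For $Z\in\mathfrak g$ let $Z_P(p)=\frac{d}{dt}\big|_{t=0}\,p\cdot\exp(tZ)$. * $C^\infty(P,W)^G$ is the space of maps $\psi:P\to W$ with $\psi(p\cdot g)=g^{-1}\cdot\psi(p)$. * $\mathscr C(P)$ is the space of principal connections: $\mathfrak g$-valued $1$-forms $\omega$ on $P$ with $\omega(Z_P)=Z$ for all $Z\in\mathfrak g$ and $\omega\circ T\rho_g=\mathrm{Ad}(g^{-1})\circ\omega$ for all $g\in G$. For $\omega\in\mathscr C(P)$ and $\psi : P\to W$, the covariant differential is $d^\omega\psi(p)=d\psi(p)\circ P_H$, where $P_H X=X-(\omega(X))_P(p)$ for $X\in T_pP$ is the projection onto the horizontal subspace $\ker\omega_p$. * A gauge transformation is a diffeomorphism $f:P\to P$ with $\pi\circ f=\pi$ and $f(p\cdot g)=f(p)\cdot g$ for all $p\in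 P$, $g\in G$. It acts by $f^*\psi=\psi\circ f$ on $C^\infty(P,W)^G$ and by pullback of forms, $f^*\omega=\omega\circ Tf$, on $\mathscr C(P)$. * $J^1(P,W)$ is the bundle of $1$-jets of maps from $P$ to $W$, whose points are the triples $(p,w,\xi)$ with $p\in P$, $w\in W$ and $\xi: T_pP\to W$ linear. An interaction Lagrangian is a smooth function $L_i:J^1(P,W)\to\mathbb R$ with $$L_i(p,w,\xi)=L_i\big(p\cdot g,\;g^{-1}\cdot w,\;g^{-1}\cdot\xi\circ T\rho_{g^{-1}}\big)\qquad\text{for all } g\in G.$$ It is called $G$-invariant if moreover $L_i(p,w,\xi)=L_i(p,g\cdot w,g\cdot\xi)$ for all $g\in G$ and all $(p,w,\xi)\in J^1(P,W)$. **Theorem (gauge invariance of the interaction action density).** Let $L_i$ be a $G$-invariant interaction Lagrangian. Then $$\mathscr L_i(\psi,\omega)(m):=L_i\big(p,\psi(p),d^\omega\psi(p)\big),\qquad p\in\pi^{-1}(m),$$ does not depend on the choice of $p\in\pi^{-1}(m)$ and gives a well-defined map $\mathscr L_i : C^\infty(P,W)^G\times\mathscr C(P)\to C^\infty(M)$; in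 particular $\mathscr L_i(\psi,\omega)$ is a smooth function on $M$. This map is gauge invariant: $$\mathscr L_i(f^*\psi,f^*\omega)=\mathscr L_i(\psi,\omega)$$ for every $\psi\in C^\infty(P,W)^G$, every $\omega\in\mathscr C(P)$ and every gauge transformation $f$ of $P$. -/

import Mathlib

open scoped Manifold ContDiff

noncomputable section

namespace GaugeTheory

section Basic

variable {EM HM M EG HG G EP HP P W : Type*}
  [NormedAddCommGroup EM] [NormedSpace ℝ EM] [TopologicalSpace HM]
  [TopologicalSpace M] [ChartedSpace HM M]
  [NormedAddCommGroup EG] [NormedSpace ℝ EG] [TopologicalSpace HG]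
  [TopologicalSpace G] [ChartedSpace HG G] [Group G]
  [NormedAddCommGroup EP] [NormedSpace ℝ EP] [TopologicalSpace HP]
  [TopologicalSpace P] [ChartedSpace HP P]
  [NormedAddCommGroup W] [NormedSpace ℝ W]

/-- A smooth principal `G`-bundle `proj : P → M`, given by its bundle projection, the principal
right action `(p, g) ↦ p · g` of `G` on `P`, and the existence, around every point of the base, of a
`G`-equivariant fibre-respecting diffeomorphism `proj ⁻¹ U ≅ U × G`. -/
structure PrincipalBundle (IM : ModelWithCorners ℝ EM HM) (M : Type*) [TopologicalSpace M]
    [ChartedSpace HM M] (IG : ModelWithCorners ℝ EG HG) (G : Type*) [TopologicalSpace G]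
    [ChartedSpace HG G] [Group G] (IP : ModelWithCorners ℝ EP HP) (P : Type*)
    [TopologicalSpace P] [ChartedSpace HP P] where
  /-- the bundle projection -/
  proj : P → M
  proj_smooth : ContMDiff IP IM ∞ proj
  /-- the principal right action, `act p g = p · g` -/
  act : P → G → P
  act_smooth : ContMDiff (IP.prod IG) IP ∞ (fun x : P × G => act x.1 x.2)
  act_one : ∀ p, act p 1 = p
  act_mul : ∀ p g h, act p (g * h) = act (act p g) h
  proj_act : ∀ p g, proj (act p g) = proj p
  exists_trivialization : ∀ m : M, ∃ (U : Set M) (e : OpenPartialHomeomorph P (M × G)),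
    IsOpen U ∧ m ∈ U ∧ e.source = proj ⁻¹' U ∧ e.target = U ×ˢ Set.univ ∧
    ContMDiffOn IP (IM.prod IG) ∞ e e.source ∧
    ContMDiffOn (IM.prod IG) IP ∞ e.symm e.target ∧
    (∀ p ∈ e.source, (e p).1 = proj p) ∧
    (∀ p ∈ e.source, ∀ g, e (act p g) = (proj p, (e p).2 * g))

/-- The adjoint representation of a Lie group on its Lie algebra `T_1 G`: `Ad g` is the derivative
at `1` of the conjugation `h ↦ g h g⁻¹`. (The derivative takes values in the tangent space at
`g * 1 * g⁻¹`, and this point is `1`.) -/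
def Ad (IG : ModelWithCorners ℝ EG HG) (g : G) :
    GroupLieAlgebra IG G →L[ℝ] GroupLieAlgebra IG G :=
  (mfderiv IG IG (fun h : G => g * h * g⁻¹) 1 : EG →L[ℝ] EG)

/-- The bundle `J¹(P, W)` of `1`-jets of maps from `P` to the vector space `W`: the vector bundle
over `P` whose fibre at `p` is `W × Hom(T_p P, W)`. Its points are the triples `(p, w, ξ)`, where
`w` is the value and `ξ` the derivative at `p` of a map from `P` to `W`, with `T_w W` identified
with `W`. -/
abbrev JetBundle (IP : ModelWithCorners ℝ EP HP) (P : Type*) [TopologicalSpace P]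
    [ChartedSpace HP P] (W : Type*) [NormedAddCommGroup W] [NormedSpace ℝ W] :=
  Bundle.TotalSpace (W × (EP →L[ℝ] W))
    (fun p : P => Bundle.Trivial P W p × (TangentSpace IP p →L[ℝ] Bundle.Trivial P W p))

/-- The jet `(p, w, ξ)`. -/
def jet (IP : ModelWithCorners ℝ EP HP) (p : P) (w : W)
    (ξ : TangentSpace IP p →L[ℝ] W) : JetBundle IP P W :=
  ⟨p, (w, ξ)⟩

/-- A function `L` on `J¹(P, W)` is `G`-invariant: `L (p, w, ξ) = L (p, g · w, g · ξ)`. -/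
def IsGInvariant {IP : ModelWithCorners ℝ EP HP} (lam : G →* (W →L[ℝ] W))
    (L : JetBundle IP P W → ℝ) : Prop :=
  ∀ (g : G) (p : P) (w : W) (ξ : TangentSpace IP p →L[ℝ] W),
    L (jet IP p w ξ) = L (jet IP p (lam g w) ((lam g).comp ξ))

/-- The form `v ↦ α_p (v)`, for `v ∈ T_p P`, on the tangent bundle is smooth. That is, `α` is a
smooth map of vector bundles `TP → P × W`, i.e. a smooth `W`-valued `1`-form on `P`. -/
def IsSmoothOneForm (IP : ModelWithCorners ℝ EP HP) [IsManifold IP ∞ P]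
    (α : ∀ p : P, TangentSpace IP p →L[ℝ] W) : Prop :=
  ContMDiff IP.tangent 𝓘(ℝ, W) ∞ (fun v : TangentBundle IP P => α v.proj v.2)

/-- The derivative `dψ(p) : T_p P → W` of a map from `P` to the vector space `W`. -/
def diff (IP : ModelWithCorners ℝ EP HP) (ψ : P → W) (p : P) : TangentSpace IP p →L[ℝ] W :=
  mfderiv IP 𝓘(ℝ, W) ψ p

namespace PrincipalBundle

variable {IM : ModelWithCorners ℝ EM HM} {IG : ModelWithCorners ℝ EG HG}
  {IP : ModelWithCorners ℝ EP HP} (B : PrincipalBundle IM M IG G IP P)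

/-- The infinitesimal action: the linear map `𝔤 → T_p P`, `Z ↦ Z_P(p)`, where `Z_P` is the
fundamental vector field of `Z`. It is the derivative at `1` of `g ↦ p · g`. (This derivative takes
values in the tangent space at `p · 1`, and this point is `p`.) -/
def fund (p : P) : GroupLieAlgebra IG G →L[ℝ] TangentSpace IP p :=
  (mfderiv IG IP (fun g : G => B.act p g) 1 : EG →L[ℝ] EP)

/-- The derivative `T_p ρ_g : T_p P → T_{p · g} P` of the right translation by `g`. -/
def tangentAct (p : P) (g : G) : TangentSpace IP p →L[ℝ] TangentSpace IP (B.act p g) :=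
  mfderiv IP IP (fun q : P => B.act q g) p

/-- The derivative `T ρ_{g⁻¹} : T_{p · g} P → T_p P` of the right translation by `g⁻¹`. (It takes
values in the tangent space at `(p · g) · g⁻¹`, and this point is `p`.) -/
def tangentActInv (p : P) (g : G) : TangentSpace IP (B.act p g) →L[ℝ] TangentSpace IP p :=
  (mfderiv IP IP (fun q : P => B.act q g⁻¹) (B.act p g) : EP →L[ℝ] EP)

lemma mdifferentiable_orbit (p : P) : MDifferentiable IG IP (fun g : G => B.act p g) :=
  (B.act_smooth.comp (contMDiff_const.prodMk contMDiff_id)).mdifferentiable (by simp)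

lemma mdifferentiable_act (g : G) : MDifferentiable IP IP (fun q : P => B.act q g) :=
  (B.act_smooth.comp (contMDiff_id.prodMk contMDiff_const)).mdifferentiable (by simp)

/-- A gauge transformation: a diffeomorphism of `P` over the identity of the base which commutes
with the principal right action. -/
structure GaugeTransformation where
  toDiffeo : Diffeomorph IP IP P P ∞
  proj_comp : ∀ p, B.proj (toDiffeo p) = B.proj p
  equivariant : ∀ p g, toDiffeo (B.act p g) = B.act (toDiffeo p) g

/-- The space `C^∞(P, W)^G` of smooth maps `ψ : P → W` with `ψ (p · g) = g⁻¹ · ψ p`, where `G` acts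
on `W` through the representation `lam`. -/
structure EquivariantMap (lam : G →* (W →L[ℝ] W)) where
  toFun : P → W
  smooth : ContMDiff IP 𝓘(ℝ, W) ∞ toFun
  equivariant : ∀ p g, toFun (B.act p g) = lam g⁻¹ (toFun p)

/-- The space `𝒞(P)` of principal connections: smooth `𝔤`-valued `1`-forms `A` on `P` with
`A (Z_P) = Z` and `A ∘ T ρ_g = Ad (g⁻¹) ∘ A`. -/
structure PrincipalConnection [IsManifold IP ∞ P] where
  form : ∀ p : P, TangentSpace IP p →L[ℝ] GroupLieAlgebra IG G
  smooth : IsSmoothOneForm (W := EG) IP form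
  form_fund : ∀ (p : P) (Z : GroupLieAlgebra IG G), form p (B.fund p Z) = Z
  equivariant : ∀ (p : P) (g : G) (X : TangentSpace IP p),
    form (B.act p g) (B.tangentAct p g X) = Ad IG g⁻¹ (form p X)

section Connection

variable {B} [IsManifold IP ∞ P]

/-- The projection `P_H` of `T_p P` onto the horizontal subspace at `p` along the vertical one:
`P_H X = X - (A X)_P(p)`. -/
def PrincipalConnection.horProj (A : B.PrincipalConnection) (p : P) :
    TangentSpace IP p →L[ℝ] TangentSpace IP p :=
  ContinuousLinearMap.id ℝ (TangentSpace IP p) - (B.fund p).comp (A.form p)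

/-- The covariant differential `d^A ψ = dψ ∘ P_H` of a map `ψ : P → W`. -/
def PrincipalConnection.covDiff (A : B.PrincipalConnection) (ψ : P → W) (p : P) :
    TangentSpace IP p →L[ℝ] W :=
  (diff IP ψ p).comp (A.horProj p)

/-- The pullback `f^* A` of a principal connection by a gauge transformation. -/
def PrincipalConnection.pullback (f : B.GaugeTransformation) (A : B.PrincipalConnection) :
    B.PrincipalConnection where
  form p := (A.form (f.toDiffeo p)).comp (mfderiv IP IP f.toDiffeo p)
  smooth := by
    have h1 : ContMDiff IP.tangent IP.tangent ∞ (tangentMap IP IP f.toDiffeo) :=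
      f.toDiffeo.contMDiff.contMDiff_tangentMap (by simp)
    exact A.smooth.comp h1
  form_fund p Z := by
    have hf : MDifferentiable IP IP f.toDiffeo := f.toDiffeo.contMDiff.mdifferentiable (by simp)
    have h1 : (mfderiv IP IP f.toDiffeo p : EP →L[ℝ] EP) (B.fund p Z)
        = B.fund (f.toDiffeo p) Z := by
      have h2 : (mfderiv IP IP f.toDiffeo p : EP →L[ℝ] EP)
          = mfderiv IP IP f.toDiffeo (B.act p 1) := by rw [B.act_one]
      have h3 := mfderiv_comp (I := IG) (I' := IP) (I'' := IP) (1 : G)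
        (f := fun g : G => B.act p g) (g := f.toDiffeo) (hf _) (B.mdifferentiable_orbit p 1)
      have h4 : (f.toDiffeo ∘ fun g : G => B.act p g)
          = fun g : G => B.act (f.toDiffeo p) g := by
        funext g; exact f.equivariant p g
      rw [h4] at h3
      rw [h2]
      exact (DFunLike.congr_fun h3 Z).symm
    exact (congrArg (A.form (f.toDiffeo p)) h1).trans (A.form_fund _ Z)
  equivariant p g X := by
    have hf : MDifferentiable IP IP f.toDiffeo := f.toDiffeo.contMDiff.mdifferentiable (by simp)
    have h1 := mfderiv_comp (I := IP) (I' := IP) (I'' := IP) p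
      (f := fun q : P => B.act q g) (g := f.toDiffeo) (hf _) (B.mdifferentiable_act g p)
    have h2 := mfderiv_comp (I := IP) (I' := IP) (I'' := IP) p
      (f := f.toDiffeo) (g := fun q : P => B.act q g) (B.mdifferentiable_act g _) (hf p)
    have h3 : (f.toDiffeo ∘ fun q : P => B.act q g)
        = (fun q : P => B.act q g) ∘ f.toDiffeo := by
      funext q; exact f.equivariant q g
    have h4 : (mfderiv IP IP f.toDiffeo (B.act p g) : EP →L[ℝ] EP) (B.tangentAct p g X)
        = B.tangentAct (f.toDiffeo p) g (mfderiv IP IP f.toDiffeo p X) := by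
      rw [h3] at h1
      exact DFunLike.congr_fun (h1.symm.trans h2) X
    have h5 : (A.form (f.toDiffeo (B.act p g)) : EP →L[ℝ] EG)
        = A.form (B.act (f.toDiffeo p) g) := by rw [f.equivariant]
    exact (congrArg (A.form (f.toDiffeo (B.act p g)) : EP →L[ℝ] EG) h4).trans
      ((DFunLike.congr_fun h5 _).trans (A.equivariant _ g _))

/-- The pullback `f^* ψ = ψ ∘ f` of an equivariant map by a gauge transformation. -/
def EquivariantMap.pullback {lam : G →* (W →L[ℝ] W)} (f : B.GaugeTransformation)
    (ψ : B.EquivariantMap lam) : B.EquivariantMap lam where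
  toFun p := ψ.toFun (f.toDiffeo p)
  smooth := ψ.smooth.comp f.toDiffeo.contMDiff
  equivariant p g := by rw [f.equivariant, ψ.equivariant]

end Connection

/-- An interaction Lagrangian: a smooth function `L : J¹(P, W) → ℝ` which is invariant under the
action of `G` on `J¹(P, W)` induced by the principal right action,
`L (p, w, ξ) = L (p · g, g⁻¹ · w, g⁻¹ · ξ ∘ T ρ_{g⁻¹})`. -/
structure IsInteractionLagrangian [IsManifold IP ∞ P] (lam : G →* (W →L[ℝ] W))
    (L : JetBundle IP P W → ℝ) : Prop where
  smooth : ContMDiff (IP.prod 𝓘(ℝ, W × (EP →L[ℝ] W))) 𝓘(ℝ, ℝ) ∞ L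
  invariant : ∀ (p : P) (g : G) (w : W) (ξ : TangentSpace IP p →L[ℝ] W),
    L (jet IP p w ξ) = L (jet IP (B.act p g) (lam g⁻¹ w)
      ((lam g⁻¹).comp (ξ.comp (B.tangentActInv p g))))

/-- `𝓛 : C^∞(P, W)^G × 𝒞(P) → C^∞(M)` is the interaction action density of `L`:
`𝓛 (ψ, A) (m) = L (p, ψ p, d^A ψ p)` for every `m` and every `p` in the fibre over `m`. -/
def IsActionDensity [IsManifold IP ∞ P] {lam : G →* (W →L[ℝ] W)} (L : JetBundle IP P W → ℝ)
    (𝓛 : B.EquivariantMap lam → B.PrincipalConnection → C^∞⟮IM, M; ℝ⟯) : Prop :=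
  ∀ (ψ : B.EquivariantMap lam) (A : B.PrincipalConnection) (m : M) (p : P), B.proj p = m →
    𝓛 ψ A m = L (jet IP p (ψ.toFun p) (A.covDiff ψ.toFun p))

end PrincipalBundle

end Basic

end GaugeTheory

end

/-! Independence of the point in the fibre: `d^A ψ` at `p · g` is `g⁻¹ ∘ d^A ψ(p) ∘ T ρ_{g⁻¹}`
(`covDiff_act`), so moving `p` along its fibre moves the whole jet by the action under which `L` is
invariant. Smoothness on `M` follows by composing the smooth jet field `p ↦ (p, ψ p, d^A ψ p)` with
local sections of the bundle.

Gauge invariance: locally `f q = q · u q`, so `T_p f` is `T ρ_{u p}` plus a vertical term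
(`exists_mfderiv_eq`). Since `d^{f^*A} (f^*ψ) = d^A ψ ∘ T f` (`covDiff_pullback`) and `d^A ψ` kills
vertical vectors, the derivative of `u` drops out and `d^{f^*A} (f^*ψ)(p) = (u p)⁻¹ · d^A ψ(p)`;
likewise `f^*ψ (p) = (u p)⁻¹ · ψ p`. The jet thus changes only by a group element acting on `W`,
over the same `p`, which `G`-invariance absorbs. -/

noncomputable section

namespace GaugeTheory

/-! ### Smooth sections of the jet bundle -/

section Smoothness

variable {E H M F V W : Type*}
  [NormedAddCommGroup E] [NormedSpace ℝ E] [TopologicalSpace H] {I : ModelWithCorners ℝ E H}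
  [TopologicalSpace M] [ChartedSpace H M]
  [NormedAddCommGroup F] [NormedSpace ℝ F] [FiniteDimensional ℝ F]
  [NormedAddCommGroup V] [NormedSpace ℝ V]
  [NormedAddCommGroup W] [NormedSpace ℝ W]

/-- A map into the continuous linear maps out of a finite-dimensional space is smooth if all its
evaluations are. -/
lemma contMDiffAt_clm_of_apply {n : WithTop ℕ∞} {f : M → F →L[ℝ] V} {x : M}
    (h : ∀ v, ContMDiffAt I 𝓘(ℝ, V) n (fun y => f y v) x) :
    ContMDiffAt I 𝓘(ℝ, F →L[ℝ] V) n f x := by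
  let d := Module.finrank ℝ F
  have hd : d = Module.finrank ℝ (Fin d → ℝ) := (Module.finrank_fin_fun ℝ).symm
  let e₁ := ContinuousLinearEquiv.ofFinrankEq hd
  -- A basis of `F` turns a linear map into the finite tuple of its values on basis vectors.
  let e₂ := (e₁.arrowCongr (1 : V ≃L[ℝ] V)).trans (ContinuousLinearEquiv.piRing (Fin d))
  have h₁ : ContMDiffAt I 𝓘(ℝ, Fin d → V) n (fun y => e₂ (f y)) x :=
    contMDiffAt_pi_space.2 fun i => h _
  have h₂ := (e₂.symm : (Fin d → V) →L[ℝ] (F →L[ℝ] V)).contMDiff.contMDiffAt.comp x h₁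
  refine h₂.congr_of_eventuallyEq (Filter.Eventually.of_forall fun y => ?_)
  exact (e₂.symm_apply_apply (f y)).symm

variable [FiniteDimensional ℝ E] [IsManifold I ∞ M]

/-- A smooth map `u : M → W` and a smooth `W`-valued `1`-form `α` on `M` give a smooth section
`p ↦ (p, u p, α p)` of the jet bundle. -/
lemma contMDiff_jet {u : M → W} {α : ∀ p : M, TangentSpace I p →L[ℝ] W}
    (hu : ContMDiff I 𝓘(ℝ, W) ∞ u) (hα : IsSmoothOneForm I α) :
    ContMDiff I (I.prod 𝓘(ℝ, W × (E →L[ℝ] W))) ∞ (fun p => jet I p (u p) (α p)) := by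
  intro p₀
  refine Bundle.contMDiffAt_totalSpace.2 ⟨contMDiffAt_id, ?_⟩
  refine ContMDiffAt.prodMk_space (hu p₀) ?_
  refine contMDiffAt_clm_of_apply fun v => ?_
  let e := trivializationAt E (TangentSpace I : M → Type _) p₀
  have he : p₀ ∈ e.baseSet := FiberBundle.mem_baseSet_trivializationAt' p₀
  -- In the trivializations at `p₀`, the evaluation of `α` at `v` is `α` applied to the local vector
  -- field with constant coordinate `v`, which is smooth.
  have h₁ : ContMDiffAt I I.tangent ∞ (fun q : M => e.toOpenPartialHomeomorph.symm (q, v)) p₀ := by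
    have h₂ := (e.contMDiffOn_symm (IB := I) (n := ∞)).contMDiffAt (x := (p₀, v))
      (e.open_target.mem_nhds (e.mem_target.2 he))
    exact ContMDiffAt.comp (f := fun q : M => (q, v)) p₀ h₂
      (contMDiffAt_id.prodMk contMDiffAt_const)
  refine ((hα _).comp p₀ h₁).congr_of_eventuallyEq ?_
  filter_upwards [e.open_baseSet.mem_nhds he] with q hq
  have h₃ : e.toOpenPartialHomeomorph.symm (q, v) = ⟨q, e.symm q v⟩ := (e.mk_symm hq v).symm
  have h₄ := congrArg Prod.snd (hom_trivializationAt_apply (σ := RingHom.id ℝ) (F₁ := E)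
    (E₁ := (TangentSpace I : M → Type _)) (F₂ := W) (E₂ := Bundle.Trivial M W) p₀ ⟨q, α q⟩)
  refine (DFunLike.congr_fun h₄ v).trans ?_
  have h₅ : (trivializationAt W (Bundle.Trivial M W) p₀).continuousLinearMapAt ℝ q
      = ContinuousLinearMap.id ℝ W :=
    Bundle.Trivial.continuousLinearMapAt_trivialization ℝ M W q
  rw [Function.comp_apply, h₃]
  refine (DFunLike.congr_fun h₅ _).trans ?_
  exact congrArg (α q) (e.symmL_apply (R := ℝ) hq v)

end Smoothness

/-! ### Fibres, local sections and right translations -/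

namespace PrincipalBundle

variable {EM HM M EG HG G EP HP P W : Type*}
  [NormedAddCommGroup EM] [NormedSpace ℝ EM] [TopologicalSpace HM]
  [TopologicalSpace M] [ChartedSpace HM M]
  [NormedAddCommGroup EG] [NormedSpace ℝ EG] [TopologicalSpace HG]
  [TopologicalSpace G] [ChartedSpace HG G] [Group G]
  [NormedAddCommGroup EP] [NormedSpace ℝ EP] [TopologicalSpace HP]
  [TopologicalSpace P] [ChartedSpace HP P]
  [NormedAddCommGroup W] [NormedSpace ℝ W]
  {IM : ModelWithCorners ℝ EM HM} {IG : ModelWithCorners ℝ EG HG}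
  {IP : ModelWithCorners ℝ EP HP} (B : PrincipalBundle IM M IG G IP P)

lemma act_act_inv (p : P) (g : G) : B.act (B.act p g) g⁻¹ = p := by
  rw [← B.act_mul, mul_inv_cancel, B.act_one]

lemma act_inv_act (p : P) (g : G) : B.act (B.act p g⁻¹) g = p := by
  rw [← B.act_mul, inv_mul_cancel, B.act_one]

/-- In an equivariant trivialization the action is right translation on the factor `G`, which is
transitive. -/
lemma exists_act_eq {p q : P} (h : B.proj p = B.proj q) : ∃ g, q = B.act p g := by
  obtain ⟨U, e, -, hU, hs, -, -, -, h₁, h₂⟩ := B.exists_trivialization (B.proj p)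
  have hp : p ∈ e.source := hs ▸ hU
  have hq : q ∈ e.source := by rw [hs, Set.mem_preimage, ← h]; exact hU
  refine ⟨(e p).2⁻¹ * (e q).2, e.injOn hq ?_ ?_⟩
  · rw [hs, Set.mem_preimage, B.proj_act]; exact hU
  · rw [h₂ p hp, mul_inv_cancel_left, h, ← h₁ q hq]

/-- The base carries local smooth sections of the bundle. -/
lemma exists_smooth_local_section (m : M) : ∃ (U : Set M) (s : M → P), IsOpen U ∧ m ∈ U ∧
    ContMDiffOn IM IP ∞ s U ∧ ∀ x ∈ U, B.proj (s x) = x := by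
  obtain ⟨U, e, hU, hm, -, ht, -, h₀, h₁, -⟩ := B.exists_trivialization m
  have hx : ∀ x ∈ U, ((x, 1) : M × G) ∈ e.target := fun x hx => by rw [ht]; exact ⟨hx, trivial⟩
  refine ⟨U, fun x => e.symm (x, 1), hU, hm,
    h₀.comp (contMDiff_id.prodMk contMDiff_const).contMDiffOn hx, fun x hxU => ?_⟩
  rw [← h₁ _ (e.map_target (hx x hxU)), e.right_inv (hx x hxU)]

lemma proj_surjective : Function.Surjective B.proj := fun m => by
  obtain ⟨U, s, -, hm, -, h⟩ := B.exists_smooth_local_section m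
  exact ⟨s m, h m hm⟩

lemma tangentAct_tangentActInv (p : P) (g : G) (X : TangentSpace IP (B.act p g)) :
    B.tangentAct p g (B.tangentActInv p g X) = X := by
  have h := mfderiv_comp (I := IP) (I' := IP) (I'' := IP) (B.act p g)
    (f := fun q : P => B.act q g⁻¹) (g := fun q : P => B.act q g)
    (B.mdifferentiable_act g _) (B.mdifferentiable_act g⁻¹ _)
  have h₁ : ((fun q : P => B.act q g) ∘ fun q : P => B.act q g⁻¹) = id :=
    funext fun q => B.act_inv_act q g
  have h₂ : (mfderiv IP IP (fun q : P => B.act q g) (B.act (B.act p g) g⁻¹) : EP →L[ℝ] EP)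
      = B.tangentAct p g := by rw [B.act_act_inv]; rfl
  rw [h₁, mfderiv_id] at h
  have h₃ := DFunLike.congr_fun h X
  exact ((DFunLike.congr_fun h₂ _).symm.trans h₃.symm)

-- Differentiate `f (p · g) = f p · g` in `g` at `1`.
variable {B} in
lemma GaugeTransformation.mfderiv_fund (f : B.GaugeTransformation) (p : P)
    (Z : GroupLieAlgebra IG G) :
    mfderiv IP IP f.toDiffeo p (B.fund p Z) = B.fund (f.toDiffeo p) Z := by
  have hf : MDifferentiable IP IP f.toDiffeo := f.toDiffeo.contMDiff.mdifferentiable (by simp)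
  have h₁ := mfderiv_comp (I := IG) (I' := IP) (I'' := IP) (1 : G)
    (f := fun g : G => B.act p g) (g := f.toDiffeo) (hf _) (B.mdifferentiable_orbit p 1)
  have h₂ : (f.toDiffeo ∘ fun g : G => B.act p g) = fun g : G => B.act (f.toDiffeo p) g :=
    funext fun g => f.equivariant p g
  have h₃ : (mfderiv IP IP f.toDiffeo (B.act p 1) : EP →L[ℝ] EP) = mfderiv IP IP f.toDiffeo p := by
    rw [B.act_one]
  rw [h₂] at h₁
  exact (DFunLike.congr_fun h₃ _).symm.trans (DFunLike.congr_fun h₁ Z).symm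

/-! ### Vertical vectors and the derivative of a gauge transformation -/

section LieGroup

variable [LieGroup IG ∞ G]

lemma contMDiff_conj (g : G) : ContMDiff IG IG ∞ (fun h : G => g * h * g⁻¹) :=
  (contMDiff_const.mul contMDiff_id).mul contMDiff_const

/-- Differentiate `(p · h) · g = (p · g) · (g⁻¹ h g)` in `h` at `1`. -/
lemma tangentAct_fund (p : P) (g : G) (Z : GroupLieAlgebra IG G) :
    B.tangentAct p g (B.fund p Z) = B.fund (B.act p g) (Ad IG g⁻¹ Z) := by
  have h₁ := mfderiv_comp (I := IG) (I' := IP) (I'' := IP) (1 : G)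
    (f := fun h : G => B.act p h) (g := fun q : P => B.act q g)
    (B.mdifferentiable_act g _) (B.mdifferentiable_orbit p _)
  have h₂ := mfderiv_comp (I := IG) (I' := IG) (I'' := IP) (1 : G)
    (f := fun h : G => g⁻¹ * h * g⁻¹⁻¹) (g := fun h : G => B.act (B.act p g) h)
    (B.mdifferentiable_orbit _ _) ((contMDiff_conj g⁻¹).mdifferentiable (by simp) _)
  have h₃ : ((fun q : P => B.act q g) ∘ fun h : G => B.act p h)
      = (fun h : G => B.act (B.act p g) h) ∘ fun h : G => g⁻¹ * h * g⁻¹⁻¹ := by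
    funext h
    simp [← B.act_mul, mul_assoc]
  rw [h₃] at h₁
  have h₄ : (mfderiv IP IP (fun q : P => B.act q g) (B.act p 1) : EP →L[ℝ] EP)
      = B.tangentAct p g := by rw [B.act_one]; rfl
  have h₅ : (mfderiv IG IP (fun h : G => B.act (B.act p g) h) (g⁻¹ * 1 * g⁻¹⁻¹) : EG →L[ℝ] EP)
      = B.fund (B.act p g) := by
    have : g⁻¹ * 1 * g⁻¹⁻¹ = 1 := by simp
    rw [this]; rfl
  have h₆ := DFunLike.congr_fun (h₁.symm.trans h₂) Z
  exact (DFunLike.congr_fun h₄ _).symm.trans (h₆.trans (DFunLike.congr_fun h₅ _))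

/-- The derivative of an orbit map `h ↦ p · h` takes values in the vertical vectors. -/
lemma exists_mfderiv_orbit_eq_fund (p : P) (g : G) (V : TangentSpace IG g) :
    ∃ Z : GroupLieAlgebra IG G,
      mfderiv IG IP (fun h : G => B.act p h) g V = B.fund (B.act p g) Z := by
  -- Writing `p · h = (p · g) · (g⁻¹ h)` moves the derivative from `g` to `1`, so `Z` is the left
  -- translate of `V`.
  have hl : ContMDiff IG IG ∞ (fun h : G => g⁻¹ * h) := contMDiff_const.mul contMDiff_id
  have h₁ := mfderiv_comp (I := IG) (I' := IG) (I'' := IP) g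
    (f := fun h : G => g⁻¹ * h) (g := fun h : G => B.act (B.act p g) h)
    (B.mdifferentiable_orbit _ _) (hl.mdifferentiable (by simp) _)
  have h₂ : ((fun h : G => B.act (B.act p g) h) ∘ fun h : G => g⁻¹ * h)
      = fun h : G => B.act p h := by
    funext h
    simp [← B.act_mul]
  have h₃ : (mfderiv IG IP (fun h : G => B.act (B.act p g) h) (g⁻¹ * g) : EG →L[ℝ] EP)
      = B.fund (B.act p g) := by rw [inv_mul_cancel]; rfl
  rw [h₂] at h₁
  exact ⟨(mfderiv IG IG (fun h : G => g⁻¹ * h) g : EG →L[ℝ] EG) V,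
    (DFunLike.congr_fun h₁ V).trans (DFunLike.congr_fun h₃ _)⟩

variable {B}

/-- A gauge transformation is locally of the form `q ↦ q · u q` with `u` smooth. -/
lemma GaugeTransformation.exists_eventuallyEq_act (f : B.GaugeTransformation) (p : P) :
    ∃ u : P → G, ContMDiffAt IP IG ∞ u p ∧ ∀ᶠ q in nhds p, f.toDiffeo q = B.act q (u q) := by
  obtain ⟨U, e, -, hU, hs, -, hse, -, h₁, h₂⟩ := B.exists_trivialization (B.proj p)
  have hp : p ∈ e.source := hs ▸ hU
  have hf : ∀ q ∈ e.source, f.toDiffeo q ∈ e.source := fun q hq => by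
    rw [hs, Set.mem_preimage] at hq ⊢
    rwa [f.proj_comp]
  have he : ∀ q ∈ e.source, ContMDiffAt IP IG ∞ (fun x => (e x).2) q := fun q hq =>
    (contMDiff_snd (I := IM) (J := IG) (n := ∞)).contMDiffAt.comp q
      (hse.contMDiffAt (e.open_source.mem_nhds hq))
  -- As `f` preserves fibres, `q` and `f q` lie in the same trivialization; `u q` is the quotient of
  -- their group coordinates.
  refine ⟨fun q => (e q).2⁻¹ * (e (f.toDiffeo q)).2,
    (he p hp).inv.mul ((he _ (hf p hp)).comp p f.toDiffeo.contMDiff.contMDiffAt), ?_⟩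
  filter_upwards [e.open_source.mem_nhds hp] with q hq
  refine e.injOn (hf q hq) ?_ ?_
  · rw [hs, Set.mem_preimage, B.proj_act]
    rwa [hs] at hq
  · rw [h₂ q hq, mul_inv_cancel_left, ← f.proj_comp, ← h₁ _ (hf q hq)]

/-- The derivative of a gauge transformation differs from that of a right translation by a vertical
vector. -/
lemma GaugeTransformation.exists_mfderiv_eq (f : B.GaugeTransformation) (p : P) :
    ∃ g : G, f.toDiffeo p = B.act p g ∧ ∀ X : TangentSpace IP p,
      ∃ Z : GroupLieAlgebra IG G, (mfderiv IP IP f.toDiffeo p X : EP)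
        = (B.tangentAct p g X : EP) + (B.fund (B.act p g) Z : EP) := by
  obtain ⟨u, hu, hfu⟩ := f.exists_eventuallyEq_act p
  refine ⟨u p, hfu.self_of_nhds, fun X => ?_⟩
  have hu' : MDifferentiableAt IP IG u p := hu.mdifferentiableAt (by simp)
  have hact : MDifferentiable (IP.prod IG) IP (fun x : P × G => B.act x.1 x.2) :=
    B.act_smooth.mdifferentiable (by simp)
  have h₁ : mfderiv IP IP f.toDiffeo p = mfderiv IP IP (fun q => B.act q (u q)) p :=
    Filter.EventuallyEq.mfderiv_eq hfu
  -- Chain rule for `q ↦ q · u q`: the `P`-slot contributes `T ρ_{u p} X`, the `G`-slot the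
  -- derivative of an orbit map, which is vertical.
  have h₂ := mfderiv_comp_apply (I := IP) (I' := IP.prod IG) (I'' := IP) p
    (f := fun q : P => (q, u q)) (g := fun x : P × G => B.act x.1 x.2)
    (hact _) (mdifferentiableAt_id.prodMk hu') X
  have h₃ := mfderiv_prodMk (I := IP) (I' := IP) (I'' := IG) (x := p) mdifferentiableAt_id hu'
  obtain ⟨Z, hZ⟩ := B.exists_mfderiv_orbit_eq_fund p (u p) (mfderiv IP IG u p X)
  refine ⟨Z, ?_⟩
  have h₄ := mfderiv_prod_eq_add_apply (I := IP) (I' := IG) (I'' := IP)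
    (p := (p, u p)) (v := mfderiv IP (IP.prod IG) (fun q : P => (q, u q)) p X) (hact (p, u p))
  have h₅ : (mfderiv IP (IP.prod IG) (fun q : P => (q, u q)) p X : EP × EG)
      = (X, mfderiv IP IG u p X) := by
    refine (DFunLike.congr_fun h₃ X).trans ?_
    rw [mfderiv_id]
    rfl
  refine (DFunLike.congr_fun h₁ X).trans (h₂.trans (h₄.trans ?_))
  refine congrArg₂ (fun a b : EP => a + b)
    (congrArg (B.tangentAct p (u p)) (congrArg Prod.fst h₅)) (Eq.trans ?_ hZ)
  exact congrArg (mfderiv IG IP (fun h : G => B.act p h) (u p)) (congrArg Prod.snd h₅)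

end LieGroup

/-! ### Equivariance and naturality of the covariant differential -/

section Representation

variable {B} {lam : G →* (W →L[ℝ] W)}

lemma EquivariantMap.mdifferentiable (ψ : B.EquivariantMap lam) :
    MDifferentiable IP 𝓘(ℝ, W) ψ.toFun := ψ.smooth.mdifferentiable (by simp)

/-- Differentiate `ψ ∘ ρ_g = g⁻¹ · ψ`; the linear map `lam g⁻¹` is its own derivative. -/
lemma EquivariantMap.diff_tangentAct (ψ : B.EquivariantMap lam) (p : P) (g : G)
    (X : TangentSpace IP p) :
    diff IP ψ.toFun (B.act p g) (B.tangentAct p g X) = lam g⁻¹ (diff IP ψ.toFun p X) := by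
  have h₁ := mfderiv_comp (I := IP) (I' := IP) (I'' := 𝓘(ℝ, W)) p
    (f := fun q : P => B.act q g) (g := ψ.toFun) (ψ.mdifferentiable _) (B.mdifferentiable_act g _)
  have h₂ := mfderiv_comp (I := IP) (I' := 𝓘(ℝ, W)) (I'' := 𝓘(ℝ, W)) p
    (f := ψ.toFun) (g := lam g⁻¹) (lam g⁻¹).mdifferentiableAt (ψ.mdifferentiable _)
  have h₃ : (ψ.toFun ∘ fun q : P => B.act q g) = lam g⁻¹ ∘ ψ.toFun :=
    funext fun q => ψ.equivariant q g
  rw [h₃] at h₁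
  rw [ContinuousLinearMap.mfderiv_eq] at h₂
  exact DFunLike.congr_fun (h₁.symm.trans h₂) X

section Connection

variable [IsManifold IP ∞ P]

lemma PrincipalConnection.covDiff_apply (A : B.PrincipalConnection) (ψ : P → W) (p : P)
    (X : TangentSpace IP p) :
    A.covDiff ψ p X = diff IP ψ p X - diff IP ψ p (B.fund p (A.form p X)) :=
  map_sub (diff IP ψ p) X (B.fund p (A.form p X))

lemma PrincipalConnection.covDiff_fund (A : B.PrincipalConnection) (ψ : P → W) (p : P)
    (Z : GroupLieAlgebra IG G) : A.covDiff ψ p (B.fund p Z) = 0 := by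
  rw [A.covDiff_apply, A.form_fund, sub_self]

/-- Covariant differentiation is natural under gauge transformations. -/
lemma PrincipalConnection.covDiff_pullback (A : B.PrincipalConnection) (ψ : B.EquivariantMap lam)
    (f : B.GaugeTransformation) (p : P) (X : TangentSpace IP p) :
    (A.pullback f).covDiff (ψ.pullback f).toFun p X
      = A.covDiff ψ.toFun (f.toDiffeo p) (mfderiv IP IP f.toDiffeo p X) := by
  have hf : MDifferentiable IP IP f.toDiffeo := f.toDiffeo.contMDiff.mdifferentiable (by simp)
  have h₁ : ∀ Y : TangentSpace IP p, diff IP (ψ.pullback f).toFun p Y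
      = diff IP ψ.toFun (f.toDiffeo p) (mfderiv IP IP f.toDiffeo p Y) := fun Y =>
    mfderiv_comp_apply (I := IP) (I' := IP) (I'' := 𝓘(ℝ, W)) p
      (f := f.toDiffeo) (g := ψ.toFun) (ψ.mdifferentiable _) (hf _) Y
  -- `T f` carries the vertical part of `X` for `f^* A` to the vertical part of `T f X` for `A`.
  rw [A.covDiff_apply, covDiff_apply, h₁, h₁, f.mfderiv_fund]
  rfl

variable [LieGroup IG ∞ G]

/-- `T ρ_g` respects vertical parts: the `Ad g⁻¹` from the equivariance of `A` is the one in
`tangentAct_fund`. -/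
lemma PrincipalConnection.covDiff_tangentAct (A : B.PrincipalConnection)
    (ψ : B.EquivariantMap lam) (p : P) (g : G) (X : TangentSpace IP p) :
    A.covDiff ψ.toFun (B.act p g) (B.tangentAct p g X) = lam g⁻¹ (A.covDiff ψ.toFun p X) := by
  rw [A.covDiff_apply, A.covDiff_apply, A.equivariant, ← B.tangentAct_fund, ψ.diff_tangentAct,
    ψ.diff_tangentAct, map_sub]

lemma PrincipalConnection.covDiff_act (A : B.PrincipalConnection) (ψ : B.EquivariantMap lam)
    (p : P) (g : G) : A.covDiff ψ.toFun (B.act p g)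
      = (lam g⁻¹).comp ((A.covDiff ψ.toFun p).comp (B.tangentActInv p g)) := by
  ext X
  have h := A.covDiff_tangentAct ψ p g (B.tangentActInv p g X)
  rwa [B.tangentAct_tangentActInv] at h

end Connection

end Representation

variable {B} {lam : G →* (W →L[ℝ] W)}

lemma isSmoothOneForm_diff [IsManifold IP ∞ P] {ψ : P → W} (hψ : ContMDiff IP 𝓘(ℝ, W) ∞ ψ) :
    IsSmoothOneForm IP (diff IP ψ) :=
  (contMDiff_snd_tangentBundle_modelSpace W 𝓘(ℝ, W)).comp
    (hψ.contMDiff_tangentMap (m := ∞) (by exact le_rfl))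

/-! ### Invariance along fibres and under gauge transformations -/

section Invariance

variable [LieGroup IG ∞ G] [IsManifold IP ∞ P] {L : JetBundle IP P W → ℝ}

lemma IsInteractionLagrangian.apply_act (hL : B.IsInteractionLagrangian lam L)
    (ψ : B.EquivariantMap lam) (A : B.PrincipalConnection) (p : P) (g : G) :
    L (jet IP (B.act p g) (ψ.toFun (B.act p g)) (A.covDiff ψ.toFun (B.act p g)))
      = L (jet IP p (ψ.toFun p) (A.covDiff ψ.toFun p)) := by
  rw [hL.invariant p g, ψ.equivariant, A.covDiff_act]

lemma IsInteractionLagrangian.apply_eq_of_proj_eq (hL : B.IsInteractionLagrangian lam L)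
    (ψ : B.EquivariantMap lam) (A : B.PrincipalConnection) {p q : P} (h : B.proj p = B.proj q) :
    L (jet IP q (ψ.toFun q) (A.covDiff ψ.toFun q))
      = L (jet IP p (ψ.toFun p) (A.covDiff ψ.toFun p)) := by
  obtain ⟨g, rfl⟩ := B.exists_act_eq h
  exact hL.apply_act ψ A p g

lemma apply_pullback (hLG : IsGInvariant lam L) (f : B.GaugeTransformation)
    (ψ : B.EquivariantMap lam) (A : B.PrincipalConnection) (p : P) :
    L (jet IP p ((ψ.pullback f).toFun p) ((A.pullback f).covDiff (ψ.pullback f).toFun p))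
      = L (jet IP p (ψ.toFun p) (A.covDiff ψ.toFun p)) := by
  obtain ⟨g, hg, hf⟩ := f.exists_mfderiv_eq p
  have h₁ : (ψ.pullback f).toFun p = lam g⁻¹ (ψ.toFun p) := by
    rw [← ψ.equivariant, ← hg]; rfl
  have h₂ : (A.pullback f).covDiff (ψ.pullback f).toFun p
      = (lam g⁻¹).comp (A.covDiff ψ.toFun p) := by
    ext X
    -- The vertical term `Z` depends on `X`, but `covDiff_fund` removes it for each `X`.
    obtain ⟨Z, hZ⟩ := hf X
    have h₃ : (A.covDiff ψ.toFun (f.toDiffeo p) : EP →L[ℝ] W)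
        = A.covDiff ψ.toFun (B.act p g) := by rw [hg]
    rw [A.covDiff_pullback]
    refine (DFunLike.congr_fun h₃ _).trans ?_
    refine (congrArg (A.covDiff ψ.toFun (B.act p g)) hZ).trans ?_
    refine (map_add (A.covDiff ψ.toFun (B.act p g)) _ _).trans ?_
    rw [A.covDiff_fund, A.covDiff_tangentAct, add_zero]
    rfl
  rw [h₁, h₂, ← hLG]

end Invariance

/-! ### Smoothness of the covariant differential and of the action density -/

variable [LieGroup IG ∞ G] [FiniteDimensional ℝ W]

lemma contMDiff_representation_inv
    (hlam : ContMDiff (IG.prod 𝓘(ℝ, W)) 𝓘(ℝ, W) ∞ (fun x : G × W => lam x.1 x.2)) :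
    ContMDiff IG 𝓘(ℝ, W →L[ℝ] W) ∞ (fun g : G => lam g⁻¹) := fun _ =>
  contMDiffAt_clm_of_apply fun _ =>
    (hlam.comp ((contMDiff_inv IG ∞).prodMk contMDiff_const)).contMDiffAt

variable (IG lam) in
/-- The infinitesimal representation sending `Z` to `d/dt exp(-tZ)` at `t = 0`: the derivative at `1` of
`g ↦ lam g⁻¹`. -/
def infinitesimalRep : GroupLieAlgebra IG G →L[ℝ] W →L[ℝ] W :=
  (mfderiv IG 𝓘(ℝ, W →L[ℝ] W) (fun g : G => lam g⁻¹) 1 : EG →L[ℝ] W →L[ℝ] W)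

/-- The derivative of an equivariant map along a fundamental vector field is given by the
infinitesimal representation. -/
lemma EquivariantMap.diff_fund
    (hlam : ContMDiff (IG.prod 𝓘(ℝ, W)) 𝓘(ℝ, W) ∞ (fun x : G × W => lam x.1 x.2))
    (ψ : B.EquivariantMap lam) (p : P) (Z : GroupLieAlgebra IG G) :
    diff IP ψ.toFun p (B.fund p Z)
      = infinitesimalRep IG lam Z (ψ.toFun p) := by
  have h₁ := mfderiv_comp (I := IG) (I' := IP) (I'' := 𝓘(ℝ, W)) (1 : G)
    (f := fun g : G => B.act p g) (g := ψ.toFun) (ψ.mdifferentiable _) (B.mdifferentiable_orbit p 1)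
  let ev := ContinuousLinearMap.apply ℝ W (ψ.toFun p)
  have h₂ := mfderiv_comp (I := IG) (I' := 𝓘(ℝ, W →L[ℝ] W)) (I'' := 𝓘(ℝ, W)) (1 : G)
    (f := fun g : G => lam g⁻¹) (g := ev) ev.mdifferentiableAt
    ((contMDiff_representation_inv hlam).mdifferentiable (by simp) _)
  -- Equivariance makes `ψ` along the orbit of `p` the map `g ↦ g⁻¹ · ψ p`; its derivative at `1` is
  -- linear in `ψ p`.
  have h₃ : (ψ.toFun ∘ fun g : G => B.act p g) = ev ∘ fun g : G => lam g⁻¹ :=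
    funext fun g => ψ.equivariant p g
  have h₄ : (mfderiv IP 𝓘(ℝ, W) ψ.toFun (B.act p 1) : EP →L[ℝ] W) = diff IP ψ.toFun p := by
    rw [B.act_one]; rfl
  rw [h₃] at h₁
  rw [ContinuousLinearMap.mfderiv_eq] at h₂
  exact (DFunLike.congr_fun h₄ _).symm.trans (DFunLike.congr_fun (h₁.symm.trans h₂) Z)

variable [IsManifold IP ∞ P]

/-- By `diff_fund` the vertical correction `dψ ((A X)_P)` equals `T (A X) (ψ p)` for a fixed linear
map `T`, so its smoothness follows from that of `A` and `ψ`, with no need to vary `fund` with `p`.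
-/
lemma PrincipalConnection.isSmoothOneForm_covDiff
    (hlam : ContMDiff (IG.prod 𝓘(ℝ, W)) 𝓘(ℝ, W) ∞ (fun x : G × W => lam x.1 x.2))
    (A : B.PrincipalConnection) (ψ : B.EquivariantMap lam) :
    IsSmoothOneForm IP (A.covDiff ψ.toFun) := by
  let T : EG →L[ℝ] W →L[ℝ] W := infinitesimalRep IG lam
  have h₁ : ContMDiff IP.tangent 𝓘(ℝ, W →L[ℝ] W) ∞
      (fun v : TangentBundle IP P => T (A.form v.proj v.2)) := T.contMDiff.comp A.smooth
  have h₂ : ContMDiff IP.tangent 𝓘(ℝ, W) ∞ (fun v : TangentBundle IP P => ψ.toFun v.proj) :=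
    ψ.smooth.comp (Bundle.contMDiff_proj _)
  have h₃ := (isSmoothOneForm_diff ψ.smooth).sub (h₁.clm_apply h₂)
  refine h₃.congr fun v => ?_
  rw [A.covDiff_apply, ψ.diff_fund hlam]
  rfl

variable [FiniteDimensional ℝ EP] {L : JetBundle IP P W → ℝ}

/-- The interaction action density of `L`, evaluated at a chosen point of each fibre. -/
def actionDensity
    (hlam : ContMDiff (IG.prod 𝓘(ℝ, W)) 𝓘(ℝ, W) ∞ (fun x : G × W => lam x.1 x.2))
    (hL : B.IsInteractionLagrangian lam L) (ψ : B.EquivariantMap lam) (A : B.PrincipalConnection) :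
    C^∞⟮IM, M; ℝ⟯ where
  val m := L (jet IP (Function.surjInv B.proj_surjective m)
    (ψ.toFun (Function.surjInv B.proj_surjective m))
    (A.covDiff ψ.toFun (Function.surjInv B.proj_surjective m)))
  property m := by
    -- The chosen points need not vary smoothly; near `m`, fibre independence allows replacing them
    -- by a smooth local section.
    obtain ⟨U, s, hU, hm, hs, hps⟩ := B.exists_smooth_local_section m
    have h := hL.smooth.comp (contMDiff_jet ψ.smooth (A.isSmoothOneForm_covDiff hlam ψ))
    refine (h.contMDiffAt.comp m (hs.contMDiffAt (hU.mem_nhds hm))).congr_of_eventuallyEq ?_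
    filter_upwards [hU.mem_nhds hm] with x hx
    exact hL.apply_eq_of_proj_eq ψ A ((hps x hx).trans (Function.surjInv_eq _ x).symm)

lemma isActionDensity_actionDensity
    (hlam : ContMDiff (IG.prod 𝓘(ℝ, W)) 𝓘(ℝ, W) ∞ (fun x : G × W => lam x.1 x.2))
    (hL : B.IsInteractionLagrangian lam L) : B.IsActionDensity L (actionDensity hlam hL) :=
  fun ψ A m _ hp => hL.apply_eq_of_proj_eq ψ A (hp.trans (Function.surjInv_eq _ m).symm)

end PrincipalBundle

end GaugeTheory

end

theorem mainTheorem11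
    {EM HM M EG HG G EP HP P W : Type*}
    [NormedAddCommGroup EM] [NormedSpace ℝ EM] [FiniteDimensional ℝ EM]
    [TopologicalSpace HM] {IM : ModelWithCorners ℝ EM HM} [IM.Boundaryless]
    [TopologicalSpace M] [ChartedSpace HM M] [IsManifold IM ∞ M]
    [NormedAddCommGroup EG] [NormedSpace ℝ EG] [FiniteDimensional ℝ EG]
    [TopologicalSpace HG] {IG : ModelWithCorners ℝ EG HG} [IG.Boundaryless]
    [TopologicalSpace G] [ChartedSpace HG G] [Group G] [LieGroup IG ∞ G]
    [NormedAddCommGroup EP] [NormedSpace ℝ EP] [FiniteDimensional ℝ EP]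
    [TopologicalSpace HP] {IP : ModelWithCorners ℝ EP HP} [IP.Boundaryless]
    [TopologicalSpace P] [ChartedSpace HP P] [IsManifold IP ∞ P]
    [NormedAddCommGroup W] [NormedSpace ℝ W] [FiniteDimensional ℝ W]
    (B : GaugeTheory.PrincipalBundle IM M IG G IP P)
    (lam : G →* (W →L[ℝ] W))
    (hlam : ContMDiff (IG.prod 𝓘(ℝ, W)) 𝓘(ℝ, W) ∞ (fun x : G × W => lam x.1 x.2))
    (L : GaugeTheory.JetBundle IP P W → ℝ)
    (hL : B.IsInteractionLagrangian lam L)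
    (hLG : GaugeTheory.IsGInvariant lam L) :
    (∃! 𝓛 : B.EquivariantMap lam → B.PrincipalConnection → C^∞⟮IM, M; ℝ⟯,
      B.IsActionDensity L 𝓛) ∧
    ∀ 𝓛 : B.EquivariantMap lam → B.PrincipalConnection → C^∞⟮IM, M; ℝ⟯,
      B.IsActionDensity L 𝓛 →
      ∀ (f : B.GaugeTransformation) (ψ : B.EquivariantMap lam) (A : B.PrincipalConnection),
        𝓛 (ψ.pullback f) (A.pullback f) = 𝓛 ψ A := by
  refine ⟨⟨GaugeTheory.PrincipalBundle.actionDensity hlam hL,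
    GaugeTheory.PrincipalBundle.isActionDensity_actionDensity hlam hL, fun 𝓛 h𝓛 => ?_⟩,
    fun 𝓛 h𝓛 f ψ A => ?_⟩
  · funext ψ A
    ext m
    obtain ⟨p, hp⟩ := B.proj_surjective m
    rw [h𝓛 ψ A m p hp,
      GaugeTheory.PrincipalBundle.isActionDensity_actionDensity hlam hL ψ A m p hp]
  · ext m
    obtain ⟨p, hp⟩ := B.proj_surjective m
    rw [h𝓛 _ _ m p hp, h𝓛 ψ A m p hp, GaugeTheory.PrincipalBundle.apply_pullback hLG]
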